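/- Let $k \ge 3$. Call a non-empty connected open set $\Omega \subset \mathbb C^k$ a *Short $\mathbb C^k$* if 1. $\Omega = \bigcup_{j} U_j$ for open sets $U_1 \subset U_2 \subset \cdots$, each biholomorphic to the unit ball of $\mathbb C^k$; 2. the infinitesimal Kobayashi metric of $\Omega$ vanishes identically, i.e. for all $p \in \Omega$ and $\xi \in \mathbb C^k$, $$\inf\{\alpha > 0 : \text{there is a holomorphic } f : \Delta \to \Omega \text{ with } f(0) = p,\ \alpha f'(0) = \xi\} = 0,$$ where $\Delta \subset \mathbb C$ is the open unit disc; 3. there is a plurisubharmonic function $\varphi : \mathbb C^k \to \mathbb R$, bounded below and non-constant on $\Omega$, such that $\Omega = \{z \in \mathbb C^k : \varphi(z) < 0\}$. (In particular $\Omega$ carries a bounded non-constant plurisubharmonic function.) Then there exist $k-1$ Short $\mathbb C^k$'s $\Omega_1, \dots, \Omega_{k-1} \subset \mathbb C^k$ with $\Omega_i \cap \Omega_j = \emptyset$ for all $i \ne j$. -/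

import Mathlib

namespace ShortCk

open scoped ENNReal

/-- `U` and `V` are biholomorphic: there are mutually inverse holomorphic maps between them. -/
def Biholomorphic {k : ℕ} (U V : Set (EuclideanSpace ℂ (Fin k))) : Prop :=
  ∃ f g : EuclideanSpace ℂ (Fin k) → EuclideanSpace ℂ (Fin k),
    DifferentiableOn ℂ f U ∧ DifferentiableOn ℂ g V ∧
    Set.MapsTo f U V ∧ Set.MapsTo g V U ∧ Set.InvOn g f U V

/-- The infinitesimal Kobayashi (Royden) metric of `Ω` at `p` in the direction `ξ`: the infimum of
the `α > 0` such that some holomorphic `f` from the unit disc to `Ω` has `f 0 = p` and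
`α f'(0) = ξ`. -/
noncomputable def kobayashiMetric {k : ℕ} (Ω : Set (EuclideanSpace ℂ (Fin k)))
    (p ξ : EuclideanSpace ℂ (Fin k)) : ℝ≥0∞ :=
  ⨅ (α : ℝ) (_ : 0 < α ∧ ∃ f : ℂ → EuclideanSpace ℂ (Fin k),
      DifferentiableOn ℂ f (Metric.ball 0 1) ∧ Set.MapsTo f (Metric.ball 0 1) Ω ∧
      f 0 = p ∧ (α : ℂ) • deriv f 0 = ξ), ENNReal.ofReal α

/-- Plurisubharmonicity on `U` of a function that nowhere takes the value `-∞`: upper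
semicontinuity, and the sub-mean value inequality on every closed complex disc
`{p + ζ ξ : |ζ| ≤ 1}` inside `U`. For a finite-valued function, the inequality with the mean
computed in `[-∞, ∞)` forces the mean to be finite; this is the integrability clause. -/
def PlurisubharmonicOn {k : ℕ} (φ : EuclideanSpace ℂ (Fin k) → ℝ)
    (U : Set (EuclideanSpace ℂ (Fin k))) : Prop :=
  UpperSemicontinuousOn φ U ∧
  ∀ p ξ : EuclideanSpace ℂ (Fin k), (∀ ζ : ℂ, ‖ζ‖ ≤ 1 → p + ζ • ξ ∈ U) →
    CircleIntegrable (fun ζ : ℂ => φ (p + ζ • ξ)) 0 1 ∧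
    φ p ≤ Real.circleAverage (fun ζ : ℂ => φ (p + ζ • ξ)) 0 1

/-- A Short `ℂ^k`: a domain in `ℂ^k` that is an increasing union of domains biholomorphic to the
unit ball, whose infinitesimal Kobayashi metric vanishes identically, and that is the sublevel set
`{φ < 0}` of a plurisubharmonic function on `ℂ^k` which is bounded below and not constant on the
domain. In particular the domain carries a bounded nonconstant plurisubharmonic function. -/
structure IsShort {k : ℕ} (Ω : Set (EuclideanSpace ℂ (Fin k))) : Prop where
  isOpen : IsOpen Ω
  isConnected : IsConnected Ω
  exhaustion : ∃ U : ℕ → Set (EuclideanSpace ℂ (Fin k)),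
    (∀ j, IsOpen (U j)) ∧ (∀ j, U j ⊆ U (j + 1)) ∧
    (∀ j, Biholomorphic (U j) (Metric.ball 0 1)) ∧ Ω = ⋃ j, U j
  kobayashi_eq_zero : ∀ p ∈ Ω, ∀ ξ, kobayashiMetric Ω p ξ = 0
  sublevel : ∃ φ : EuclideanSpace ℂ (Fin k) → ℝ,
    PlurisubharmonicOn φ Set.univ ∧ (∃ c : ℝ, ∀ z, c ≤ φ z) ∧
    Ω = {z | φ z < 0} ∧ ∃ z ∈ Ω, ∃ w ∈ Ω, φ z ≠ φ w

end ShortCk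

/-! The model domain is the basin of the origin for a non-autonomous sequence of polynomial
automorphisms `squareShift (param n)`. They are quadratic in all but the last coordinate, with
linear terms that decay doubly exponentially. The basin is the increasing union of the preimages of
the ball of radius 1/2 under `flow n`, hence of biholomorphic balls.

The truncated size `max ‖flow n x‖ (param n)` satisfies `s' ≤ 2 * s ^ 2` (`size_succ_le`). Hence
`potential` decreases to a plurisubharmonic function `green`, bounded below by the truncation, whose
negativity set is the basin (`green_neg_iff`). It is non-constant because orbits of nonnegative real
points cannot shrink faster than by squaring (`pow_le_size`). The Kobayashi metric vanishes because
derivatives along orbits tend to zero, so large affine discs can be pulled back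
(`kobayashiMetric_green_neg`).

The basin stays near the last axis: a large dominating coordinate off that axis never decreases
(`norm_apply_lt_of_green_neg`). Copies turned towards distinct axes therefore meet only where their
axis coordinates are small. One axis is kept in reserve, and translations along it separate what
remains; this leaves `k - 1` copies. -/

namespace ShortCk

open Metric Set Filter Topology MeasureTheory

/-! ### Sub-mean value inequalities and plurisubharmonic functions -/

/-- The sub-mean value inequality for `log ‖h‖` on the unit circle. -/
lemma log_norm_le_circleAverage {h : ℂ → ℂ} (hh : Differentiable ℂ h) (h0 : h 0 ≠ 0) :
    Real.log ‖h 0‖ ≤ Real.circleAverage (fun ζ => Real.log ‖h ζ‖) 0 1 := by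
  have han : AnalyticOnNhd ℂ h (closedBall 0 |1|) := fun z _ => hh.analyticAt z
  -- Jensen's formula: each zero `u` in the closed disc contributes its multiplicity times `log (1 /
  -- ‖u‖) ≥ 0`.
  rw [han.circleAverage_log_norm one_ne_zero h0]
  refine le_add_of_nonneg_left (finsum_nonneg fun u => ?_)
  by_cases hu : u ∈ closedBall (0 : ℂ) |1|
  · refine mul_nonneg (mod_cast MeromorphicOn.AnalyticOnNhd.divisor_nonneg han u) ?_
    have hu1 : ‖u‖ ≤ 1 := by simpa using hu
    rw [one_mul, zero_sub, norm_neg, Real.log_inv]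
    exact neg_nonneg.2 (Real.log_nonpos (norm_nonneg _) hu1)
  · simp [Function.locallyFinsuppWithin.apply_eq_zero_of_notMem _ hu]

lemma continuous_log_max_norm {X E : Type*} [TopologicalSpace X] [NormedAddCommGroup E]
    {g : X → E} (hg : Continuous g) {c : ℝ} (hc : 0 < c) :
    Continuous fun x => Real.log (max ‖g x‖ c) :=
  (hg.norm.max continuous_const).log fun _ => (lt_max_of_lt_right hc).ne'

/-- When `‖g 0‖ > 1`, a norming functional `l` of `g 0` reduces the claim to the scalar function `l
∘ g`, since `‖l (g ζ)‖ ≤ ‖g ζ‖`. Truncating at 1 keeps the right-hand integrand nonnegative, which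
settles the other case and the zeros of `l ∘ g`, where `Real.log 0 = 0`. -/
lemma log_max_norm_one_le_circleAverage {E : Type*} [NormedAddCommGroup E] [NormedSpace ℂ E]
    {g : ℂ → E} (hg : Differentiable ℂ g) :
    Real.log (max ‖g 0‖ 1) ≤ Real.circleAverage (fun ζ => Real.log (max ‖g ζ‖ 1)) 0 1 := by
  have hint : CircleIntegrable (fun ζ => Real.log (max ‖g ζ‖ 1)) 0 1 :=
    (continuous_log_max_norm hg.continuous one_pos).continuousOn.circleIntegrable'
  rcases le_or_gt ‖g 0‖ 1 with h0 | h0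
  · rw [max_eq_right h0, ← Real.circleAverage_const (Real.log 1) 0 1]
    exact Real.circleAverage_mono (circleIntegrable_const _ _ _) hint
      fun ζ _ => Real.log_le_log one_pos (le_max_right _ _)
  · obtain ⟨l, hl, hl0⟩ := exists_dual_vector'' ℂ (g 0)
    have hlg : Differentiable ℂ fun ζ => l (g ζ) := l.differentiable.comp hg
    have hpos : 0 < ‖g 0‖ := one_pos.trans h0
    have hnorm : ‖l (g 0)‖ = ‖g 0‖ := by rw [hl0]; simp
    have hmer : MeromorphicOn (fun ζ => l (g ζ)) (sphere 0 |1|) :=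
      fun z _ => (hlg.analyticAt z).meromorphicAt
    rw [max_eq_left h0.le, ← hnorm]
    refine (log_norm_le_circleAverage hlg (norm_pos_iff.1 (hnorm ▸ hpos))).trans ?_
    refine Real.circleAverage_mono hmer.circleIntegrable_log_norm hint fun ζ _ => ?_
    rcases eq_or_ne (l (g ζ)) 0 with hz | hz
    · simpa [hz] using Real.log_nonneg (le_max_right ‖g ζ‖ 1)
    · refine Real.log_le_log (norm_pos_iff.2 hz) (le_max_of_le_left ?_)
      exact (l.le_opNorm _).trans (mul_le_of_le_one_left (norm_nonneg _) hl)

/-- The sub-mean value inequality for `log (max ‖g‖ c)` on the unit circle. -/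
lemma log_max_norm_le_circleAverage {E : Type*} [NormedAddCommGroup E] [NormedSpace ℂ E]
    {g : ℂ → E} (hg : Differentiable ℂ g) {c : ℝ} (hc : 0 < c) :
    Real.log (max ‖g 0‖ c) ≤ Real.circleAverage (fun ζ => Real.log (max ‖g ζ‖ c)) 0 1 := by
  have hscale : ∀ ζ, Real.log (max ‖g ζ‖ c) =
      Real.log c + Real.log (max ‖(c⁻¹ : ℂ) • g ζ‖ 1) := fun ζ => by
    rw [← Real.log_mul hc.ne' (by positivity), norm_smul, norm_inv, Complex.norm_real,
      Real.norm_of_nonneg hc.le, mul_max_of_nonneg _ _ hc.le, mul_inv_cancel_left₀ hc.ne', mul_one]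
  have hd : Differentiable ℂ fun ζ => (c⁻¹ : ℂ) • g ζ := hg.const_smul _
  simp only [hscale]
  rw [Real.circleAverage_fun_add (circleIntegrable_const _ _ _)
    (continuous_log_max_norm hd.continuous one_pos).continuousOn.circleIntegrable',
    Real.circleAverage_const]
  exact add_le_add_right (log_max_norm_one_le_circleAverage hd) _

/-- A decreasing limit, bounded from below, of continuous plurisubharmonic functions is
plurisubharmonic. -/
lemma plurisubharmonicOn_iInf_of_antitone {k : ℕ} {u : ℕ → EuclideanSpace ℂ (Fin k) → ℝ} {c : ℝ}
    (hcont : ∀ n, Continuous (u n)) (hanti : ∀ x, Antitone fun n => u n x)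
    (hbd : ∀ n x, c ≤ u n x)
    (hmean : ∀ n p ξ, u n p ≤ Real.circleAverage (fun ζ : ℂ => u n (p + ζ • ξ)) 0 1) :
    PlurisubharmonicOn (fun x => ⨅ n, u n x) univ := by
  have hbdd : ∀ x, BddBelow (range fun n => u n x) := fun x =>
    ⟨c, by rintro _ ⟨n, rfl⟩; exact hbd n x⟩
  have husc : UpperSemicontinuous fun x => ⨅ n, u n x :=
    upperSemicontinuous_ciInf hbdd fun n => (hcont n).upperSemicontinuous
  have hlim : ∀ x, Tendsto (fun n => u n x) atTop (𝓝 (⨅ n, u n x)) := fun x =>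
    tendsto_atTop_ciInf (hanti x) (hbdd x)
  refine ⟨husc.upperSemicontinuousOn _, fun p ξ _ => ?_⟩
  have hline : Continuous fun θ : ℝ => p + circleMap 0 1 θ • ξ := by fun_prop
  have hmeas : Measurable fun θ : ℝ => ⨅ n, u n (p + circleMap 0 1 θ • ξ) :=
    husc.measurable.comp hline.measurable
  -- From `c ≤ u n ≤ u 0`, this is a dominating function independent of `n`.
  let b : ℝ → ℝ := fun θ => |c| + |u 0 (p + circleMap 0 1 θ • ξ)|
  have hb : Continuous b := continuous_const.add ((hcont 0).comp hline).abs
  have hbound : ∀ n θ, |u n (p + circleMap 0 1 θ • ξ)| ≤ b θ := fun n θ => by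
    have h1 := hbd n (p + circleMap 0 1 θ • ξ)
    have h2 := hanti (p + circleMap 0 1 θ • ξ) (Nat.zero_le n)
    have h3 := neg_abs_le c
    have h4 := le_abs_self (u 0 (p + circleMap 0 1 θ • ξ))
    have h5 := abs_nonneg (u 0 (p + circleMap 0 1 θ • ξ))
    have h6 := abs_nonneg c
    exact abs_le.2 ⟨by simp only [b]; linarith, by simp only [b]; dsimp only at h2; linarith⟩
  have hboundlim : ∀ θ, |⨅ n, u n (p + circleMap 0 1 θ • ξ)| ≤ b θ := fun θ =>
    le_of_tendsto (hlim _).abs (Eventually.of_forall fun n => hbound n θ)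
  refine ⟨?_, ?_⟩
  · exact (hb.intervalIntegrable _ _).mono_fun hmeas.aestronglyMeasurable
      (Eventually.of_forall fun θ => by
        simpa only [Real.norm_eq_abs] using (hboundlim θ).trans (le_abs_self _))
  · have htend : Tendsto (fun n => Real.circleAverage (fun ζ : ℂ => u n (p + ζ • ξ)) 0 1) atTop
        (𝓝 (Real.circleAverage (fun ζ : ℂ => ⨅ n, u n (p + ζ • ξ)) 0 1)) := by
      refine Tendsto.const_smul ?_ _
      refine intervalIntegral.tendsto_integral_filter_of_dominated_convergence b
        (Eventually.of_forall fun n => ((hcont n).comp hline).aestronglyMeasurable)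
        (Eventually.of_forall fun n => Eventually.of_forall fun θ _ => hbound n θ)
        (hb.intervalIntegrable _ _) (Eventually.of_forall fun θ _ => hlim _)
    exact ge_of_tendsto htend (Eventually.of_forall fun n =>
      (ciInf_le (hbdd p) n).trans (hmean n p ξ))

/-- Plurisubharmonicity is invariant under affine changes of coordinates. -/
lemma PlurisubharmonicOn.comp_affine {k : ℕ} {φ : EuclideanSpace ℂ (Fin k) → ℝ}
    (hφ : PlurisubharmonicOn φ univ)
    (L : EuclideanSpace ℂ (Fin k) →L[ℂ] EuclideanSpace ℂ (Fin k))
    (v : EuclideanSpace ℂ (Fin k)) :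
    PlurisubharmonicOn (fun x => φ (L (x - v))) univ := by
  refine ⟨?_, fun p ξ _ => ?_⟩
  · have := (upperSemicontinuousOn_univ_iff.1 hφ.1).comp (g := fun x => L (x - v)) (by fun_prop)
    exact this.upperSemicontinuousOn _
  · have h := hφ.2 (L (p - v)) (L ξ) fun _ _ => mem_univ _
    have he : ∀ ζ : ℂ, L (p + ζ • ξ - v) = L (p - v) + ζ • L ξ := fun ζ => by
      rw [← map_smul, ← map_add]; congr 1; abel
    simpa only [he] using h

/-! ### The quadratic automorphisms -/

/-- The polynomial automorphism `x ↦ (x₀² + η x₁, …, x_{m-1}² + η x_m, η x₀)`. -/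
noncomputable def squareShift {m : ℕ} (η : ℂ) (x : EuclideanSpace ℂ (Fin (m + 1))) :
    EuclideanSpace ℂ (Fin (m + 1)) :=
  WithLp.toLp 2 (Fin.snoc (fun i : Fin m => x i.castSucc ^ 2 + η * x i.succ) (η * x 0) :
    Fin (m + 1) → ℂ)

/-- The inverse of `squareShift`. -/
noncomputable def squareShiftInv {m : ℕ} (η : ℂ) (y : EuclideanSpace ℂ (Fin (m + 1))) :
    EuclideanSpace ℂ (Fin (m + 1)) :=
  WithLp.toLp 2 fun j => Fin.induction (motive := fun _ => ℂ) (y (Fin.last m) / η)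
    (fun i t => (y i.castSucc - t ^ 2) / η) j

variable {m : ℕ}

@[simp] lemma squareShift_castSucc (η : ℂ) (x : EuclideanSpace ℂ (Fin (m + 1))) (i : Fin m) :
    squareShift η x i.castSucc = x i.castSucc ^ 2 + η * x i.succ := by
  simp [squareShift]

@[simp] lemma squareShift_last (η : ℂ) (x : EuclideanSpace ℂ (Fin (m + 1))) :
    squareShift η x (Fin.last m) = η * x 0 := by
  simp [squareShift]

@[simp] lemma squareShiftInv_zero (η : ℂ) (y : EuclideanSpace ℂ (Fin (m + 1))) :
    squareShiftInv η y 0 = y (Fin.last m) / η := rfl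

@[simp] lemma squareShiftInv_succ (η : ℂ) (y : EuclideanSpace ℂ (Fin (m + 1))) (i : Fin m) :
    squareShiftInv η y i.succ = (y i.castSucc - squareShiftInv η y i.castSucc ^ 2) / η := by
  simp [squareShiftInv]

lemma squareShiftInv_squareShift {η : ℂ} (hη : η ≠ 0) (x : EuclideanSpace ℂ (Fin (m + 1))) :
    squareShiftInv η (squareShift η x) = x := by
  ext j
  induction j using Fin.induction with
  | zero => simp [hη]
  | succ i ih => simp [ih, hη]

lemma squareShift_squareShiftInv {η : ℂ} (hη : η ≠ 0) (y : EuclideanSpace ℂ (Fin (m + 1))) :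
    squareShift η (squareShiftInv η y) = y := by
  ext j
  induction j using Fin.lastCases with
  | last => simp; field_simp
  | cast i => simp; field_simp; ring

lemma differentiable_squareShift (η : ℂ) :
    Differentiable ℂ (squareShift (m := m) η) := by
  rw [differentiable_euclidean]
  intro j
  induction j using Fin.lastCases with
  | last => simp only [squareShift_last]; fun_prop
  | cast i => simp only [squareShift_castSucc]; fun_prop

lemma differentiable_squareShiftInv (η : ℂ) :
    Differentiable ℂ (squareShiftInv (m := m) η) := by
  rw [differentiable_euclidean]
  intro j
  induction j using Fin.induction with
  | zero => simp only [squareShiftInv_zero, div_eq_mul_inv]; fun_prop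
  | succ i ih => simp only [squareShiftInv_succ, div_eq_mul_inv]; fun_prop

/-- The linear part is `η` times a cyclic permutation of coordinates, an isometry; the quadratic
part is controlled by `∑ aᵢ² ≤ (∑ aᵢ)²` for `aᵢ = ‖xᵢ‖² ≥ 0`. -/
lemma norm_squareShift_le (η : ℂ) (x : EuclideanSpace ℂ (Fin (m + 1))) :
    ‖squareShift η x‖ ≤ ‖x‖ ^ 2 + ‖η‖ * ‖x‖ := by
  let A : EuclideanSpace ℂ (Fin (m + 1)) :=
    WithLp.toLp 2 (Fin.snoc (fun i : Fin m => x i.castSucc ^ 2) 0 : Fin (m + 1) → ℂ)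
  let B : EuclideanSpace ℂ (Fin (m + 1)) :=
    WithLp.toLp 2 (Fin.snoc (fun i : Fin m => x i.succ) (x 0) : Fin (m + 1) → ℂ)
  have hAB : squareShift η x = A + η • B := by
    ext j
    induction j using Fin.lastCases with
    | last => simp [A, B]
    | cast i => simp [A, B]
  have hB : ‖B‖ = ‖x‖ := by
    rw [EuclideanSpace.norm_eq, EuclideanSpace.norm_eq, Fin.sum_univ_castSucc, Fin.sum_univ_succ]
    simp [B, add_comm]
  have hA : ‖A‖ ≤ ‖x‖ ^ 2 := by
    rw [EuclideanSpace.norm_eq, EuclideanSpace.norm_sq_eq]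
    refine Real.sqrt_le_iff.2 ⟨by positivity, ?_⟩
    rw [Fin.sum_univ_castSucc, Fin.sum_univ_castSucc]
    simp only [A, Fin.snoc_castSucc, Fin.snoc_last, norm_zero, norm_pow]
    have h1 : ∑ i : Fin m, (‖x i.castSucc‖ ^ 2) ^ 2 ≤ (∑ i : Fin m, ‖x i.castSucc‖ ^ 2) ^ 2 :=
      Finset.sum_sq_le_sq_sum_of_nonneg fun _ _ => by positivity
    have h2 : 0 ≤ ∑ i : Fin m, ‖x i.castSucc‖ ^ 2 := by positivity
    have h3 : 0 ≤ ‖x (Fin.last m)‖ ^ 2 := by positivity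
    nlinarith
  rw [hAB]
  refine (norm_add_le _ _).trans ?_
  rw [norm_smul, hB]
  gcongr

/-- Points with a dominating coordinate off the last axis escape. -/
lemma exists_dominating_squareShift {η : ℂ} (hη : ‖η‖ ≤ 1) {x : EuclideanSpace ℂ (Fin (m + 1))}
    (hx : ∃ j : Fin m, 2 ≤ ‖x j.castSucc‖ ∧ ‖x (Fin.last m)‖ ≤ ‖x j.castSucc‖) :
    ∃ j : Fin m, 2 ≤ ‖squareShift η x j.castSucc‖ ∧
      ‖squareShift η x (Fin.last m)‖ ≤ ‖squareShift η x j.castSucc‖ := by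
  obtain ⟨j₀, hj₀, hlast⟩ := hx
  obtain ⟨j, -, hj⟩ := Finset.exists_max_image Finset.univ (fun i : Fin m => ‖x i.castSucc‖)
    ⟨j₀, Finset.mem_univ _⟩
  have hj₁ := hj j₀ (Finset.mem_univ _)
  have hall : ∀ i, ‖x i‖ ≤ ‖x j.castSucc‖ := fun i => by
    induction i using Fin.lastCases with
    | last => exact hlast.trans hj₁
    | cast i => exact hj i (Finset.mem_univ _)
  have h2 : 2 ≤ ‖x j.castSucc‖ := hj₀.trans hj₁
  have hmul : ∀ i, ‖η * x i‖ ≤ ‖x j.castSucc‖ := fun i => by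
    rw [norm_mul]
    exact (mul_le_of_le_one_left (norm_nonneg _) hη).trans (hall i)
  -- With `r = ‖x j.castSucc‖ ≥ 2` the largest coordinate norm, the new one is at least `r² - r ≥
  -- r`.
  have hgrow : ‖x j.castSucc‖ ≤ ‖squareShift η x j.castSucc‖ := by
    have := norm_sub_le_norm_add (x j.castSucc ^ 2) (η * x j.succ)
    rw [norm_pow] at this
    rw [squareShift_castSucc]
    nlinarith [hmul j.succ]
  refine ⟨j, h2.trans hgrow, ?_⟩
  rw [squareShift_last]
  exact (hmul 0).trans hgrow

/-! ### Orbits and their truncated size -/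

/-- The rapidly decreasing parameters `8 ^ (-2 ^ n)`. -/
noncomputable def param (n : ℕ) : ℝ := (1 / 8) ^ 2 ^ n

lemma param_pos (n : ℕ) : 0 < param n := by unfold param; positivity

lemma param_succ (n : ℕ) : param (n + 1) = param n ^ 2 := by
  rw [param, param, ← pow_mul, pow_succ]

lemma param_le (n : ℕ) : param n ≤ 1 / 8 :=
  pow_le_of_le_one (by norm_num) (by norm_num) (by positivity)

lemma norm_param_le_one (n : ℕ) : ‖(param n : ℂ)‖ ≤ 1 := by
  rw [Complex.norm_real, Real.norm_of_nonneg (param_pos n).le]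
  linarith [param_le n]

/-- The composition of the first `n` automorphisms. -/
noncomputable def flow : ℕ → EuclideanSpace ℂ (Fin (m + 1)) → EuclideanSpace ℂ (Fin (m + 1))
  | 0, x => x
  | n + 1, x => squareShift (param n : ℂ) (flow n x)

/-- The inverse of `flow`. -/
noncomputable def flowInv : ℕ → EuclideanSpace ℂ (Fin (m + 1)) → EuclideanSpace ℂ (Fin (m + 1))
  | 0, y => y
  | n + 1, y => flowInv n (squareShiftInv (param n : ℂ) y)

lemma param_ne_zero (n : ℕ) : (param n : ℂ) ≠ 0 := mod_cast (param_pos n).ne'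

lemma flowInv_flow (n : ℕ) (x : EuclideanSpace ℂ (Fin (m + 1))) : flowInv n (flow n x) = x := by
  induction n with
  | zero => rfl
  | succ n ih => rw [flow, flowInv, squareShiftInv_squareShift (param_ne_zero n), ih]

lemma flow_flowInv (n : ℕ) (y : EuclideanSpace ℂ (Fin (m + 1))) : flow n (flowInv n y) = y := by
  induction n generalizing y with
  | zero => rfl
  | succ n ih => rw [flow, flowInv, ih, squareShift_squareShiftInv (param_ne_zero n)]

lemma differentiable_flow (n : ℕ) : Differentiable ℂ (flow (m := m) n) := by
  induction n with
  | zero => exact differentiable_id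
  | succ n ih => exact (differentiable_squareShift _).comp ih

lemma differentiable_flowInv (n : ℕ) : Differentiable ℂ (flowInv (m := m) n) := by
  induction n with
  | zero => exact differentiable_id
  | succ n ih => exact ih.comp (differentiable_squareShiftInv _)

lemma flow_apply_zero (n : ℕ) : flow n (0 : EuclideanSpace ℂ (Fin (m + 1))) = 0 := by
  induction n with
  | zero => rfl
  | succ n ih =>
    have h := norm_squareShift_le (param n : ℂ) (0 : EuclideanSpace ℂ (Fin (m + 1)))
    rw [flow, ih]
    simpa using h

/-- The size of the `n`-th point of an orbit, truncated from below. -/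
noncomputable def size (n : ℕ) (x : EuclideanSpace ℂ (Fin (m + 1))) : ℝ :=
  max ‖flow n x‖ (param n)

lemma size_pos (n : ℕ) (x : EuclideanSpace ℂ (Fin (m + 1))) : 0 < size n x :=
  lt_max_of_lt_right (param_pos n)

/-- The truncation makes the linear term quadratic: both `‖flow n x‖` and `param n` are at most `s =
size n x`, so the image has norm at most `s² + s * s`. The new floor is `param n ^ 2 ≤ s²`, which is
why the parameters are squared at each step. -/
lemma size_succ_le (n : ℕ) (x : EuclideanSpace ℂ (Fin (m + 1))) :
    size (n + 1) x ≤ 2 * size n x ^ 2 := by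
  have h1 : ‖flow n x‖ ≤ size n x := le_max_left _ _
  have h2 : param n ≤ size n x := le_max_right _ _
  have h3 := param_pos n
  have h4 := norm_squareShift_le (param n : ℂ) (flow n x)
  rw [Complex.norm_real, Real.norm_of_nonneg h3.le] at h4
  have h5 := norm_nonneg (flow n x)
  refine max_le ?_ ?_
  · rw [flow]; nlinarith
  · rw [param_succ]; nlinarith

lemma size_lt_iff {n : ℕ} {x : EuclideanSpace ℂ (Fin (m + 1))} {q : ℝ} (hq : 1 / 8 < q) :
    size n x < q ↔ ‖flow n x‖ < q := by
  rw [size, max_lt_iff, and_iff_left ((param_le n).trans_lt hq)]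

lemma size_add_le (n j : ℕ) (x : EuclideanSpace ℂ (Fin (m + 1))) :
    2 * size (n + j) x ≤ (2 * size n x) ^ 2 ^ j := by
  induction j with
  | zero => simp
  | succ j ih =>
    have h1 := size_succ_le (n + j) x
    have h2 := size_pos (n + j) x
    calc 2 * size (n + (j + 1)) x ≤ (2 * size (n + j) x) ^ 2 := by
          rw [← add_assoc]; nlinarith
      _ ≤ ((2 * size n x) ^ 2 ^ j) ^ 2 := by gcongr
      _ = (2 * size n x) ^ 2 ^ (j + 1) := by rw [← pow_mul, pow_succ]

/-! ### The Green type function and its sublevel set -/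

/-- The functions `2⁻ⁿ log (2 size n)`, which decrease to a Green type function. -/
noncomputable def potential (n : ℕ) (x : EuclideanSpace ℂ (Fin (m + 1))) : ℝ :=
  (2 ^ n)⁻¹ * Real.log (2 * size n x)

lemma antitone_potential (x : EuclideanSpace ℂ (Fin (m + 1))) :
    Antitone fun n => potential n x := by
  refine antitone_nat_of_succ_le fun n => ?_
  have h := Real.log_le_log (by have := size_pos (n + 1) x; positivity) (size_add_le n 1 x)
  rw [Real.log_pow] at h
  unfold potential
  rw [pow_succ, mul_inv, mul_assoc]
  gcongr
  push_cast at h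
  linarith

/-- Source of all lower bounds for `green`: `b = 1 / 8` comes from the truncation, `b = 1 / 3` from
an explicit orbit. -/
lemma log_le_potential {n : ℕ} {x : EuclideanSpace ℂ (Fin (m + 1))} {b : ℝ} (hb : 0 < b)
    (h : b ^ 2 ^ n ≤ size n x) : Real.log b ≤ potential n x := by
  have h1 : b ^ 2 ^ n ≤ 2 * size n x := by linarith [size_pos n x]
  have h2 := Real.log_le_log (by positivity) h1
  rw [Real.log_pow] at h2
  push_cast at h2
  unfold potential
  rwa [← div_eq_inv_mul, le_div_iff₀' (by positivity)]

/-- The plurisubharmonic function whose negativity set is the basin. -/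
noncomputable def green (x : EuclideanSpace ℂ (Fin (m + 1))) : ℝ := ⨅ n, potential n x

lemma log_one_eighth_le_potential (n : ℕ) (x : EuclideanSpace ℂ (Fin (m + 1))) :
    Real.log (1 / 8) ≤ potential n x :=
  log_le_potential (by norm_num) (le_max_right _ _)

lemma bddBelow_potential (x : EuclideanSpace ℂ (Fin (m + 1))) :
    BddBelow (range fun n => potential n x) :=
  ⟨Real.log (1 / 8), by rintro _ ⟨n, rfl⟩; exact log_one_eighth_le_potential n x⟩

lemma potential_neg_iff {n : ℕ} {x : EuclideanSpace ℂ (Fin (m + 1))} :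
    potential n x < 0 ↔ ‖flow n x‖ < 1 / 2 := by
  rw [← size_lt_iff (by norm_num), potential, ← div_eq_inv_mul, div_lt_iff₀ (by positivity),
    zero_mul, Real.log_neg_iff (by have := size_pos n x; positivity)]
  constructor <;> intro h <;> linarith

lemma green_neg_iff {x : EuclideanSpace ℂ (Fin (m + 1))} :
    green x < 0 ↔ ∃ n, ‖flow n x‖ < 1 / 2 := by
  simp only [← potential_neg_iff]
  exact ⟨exists_lt_of_ciInf_lt, fun ⟨n, hn⟩ => (ciInf_le (bddBelow_potential x) n).trans_lt hn⟩

lemma norm_flow_succ_lt {n : ℕ} {x : EuclideanSpace ℂ (Fin (m + 1))} (h : ‖flow n x‖ < 1 / 2) :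
    ‖flow (n + 1) x‖ < 1 / 2 :=
  potential_neg_iff.1 ((antitone_potential x n.le_succ).trans_lt (potential_neg_iff.2 h))

lemma plurisubharmonicOn_green : PlurisubharmonicOn (green (m := m)) univ := by
  refine plurisubharmonicOn_iInf_of_antitone (u := potential) (c := Real.log (1 / 8))
    (fun n => ?_) antitone_potential log_one_eighth_le_potential fun n p ξ => ?_
  · have h := ((differentiable_flow (m := m) n).continuous.norm.max
      (continuous_const (y := param n))).const_mul 2
    exact (h.log fun x => (mul_pos two_pos (size_pos n x)).ne').const_mul _
  · have hg : Differentiable ℂ fun ζ : ℂ => flow n (p + ζ • ξ) :=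
      (differentiable_flow n).comp (by fun_prop)
    have h := log_max_norm_le_circleAverage hg (param_pos n)
    have heq : ∀ x : EuclideanSpace ℂ (Fin (m + 1)), potential n x =
        (2 ^ n : ℝ)⁻¹ • (Real.log 2 + Real.log (max ‖flow n x‖ (param n))) := fun x => by
      rw [potential, Real.log_mul two_ne_zero (size_pos n x).ne', smul_eq_mul, size]
    simp only [heq]
    rw [Real.circleAverage_fun_smul, Real.circleAverage_fun_add (circleIntegrable_const _ _ _)
      (continuous_log_max_norm hg.continuous (param_pos n)).continuousOn.circleIntegrable',
      Real.circleAverage_const, smul_eq_mul, smul_eq_mul]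
    simp only [zero_smul, add_zero] at h
    gcongr

lemma isOpen_norm_flow_lt (n : ℕ) (r : ℝ) :
    IsOpen {x : EuclideanSpace ℂ (Fin (m + 1)) | ‖flow n x‖ < r} :=
  isOpen_lt (differentiable_flow n).continuous.norm continuous_const

lemma setOf_green_neg_eq_iUnion :
    {x : EuclideanSpace ℂ (Fin (m + 1)) | green x < 0} = ⋃ n, {x | ‖flow n x‖ < 1 / 2} := by
  ext x; simp only [mem_ofPred_eq, mem_iUnion, green_neg_iff]

lemma isConnected_green_neg :
    IsConnected {x : EuclideanSpace ℂ (Fin (m + 1)) | green x < 0} := by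
  rw [setOf_green_neg_eq_iUnion]
  refine ⟨⟨0, mem_iUnion.2 ⟨0, by simp [flow_apply_zero]⟩⟩, isPreconnected_iUnion
    ⟨0, mem_iInter.2 fun n => by simp [flow_apply_zero]⟩ fun n => ?_⟩
  have himage : {x : EuclideanSpace ℂ (Fin (m + 1)) | ‖flow n x‖ < 1 / 2} =
      flowInv n '' ball 0 (1 / 2) := by
    ext x
    simp only [mem_ofPred_eq, mem_image, mem_ball_zero_iff]
    exact ⟨fun h => ⟨_, h, flowInv_flow n x⟩, by rintro ⟨y, hy, rfl⟩; rwa [flow_flowInv]⟩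
  rw [himage]
  exact (convex_ball _ _).isPreconnected.image _ (differentiable_flowInv n).continuous.continuousOn

lemma biholomorphic_norm_flow_lt (n : ℕ) :
    Biholomorphic {x : EuclideanSpace ℂ (Fin (m + 1)) | ‖flow n x‖ < 1 / 2} (ball 0 1) := by
  refine ⟨fun x => (2 : ℂ) • flow n x, fun y => flowInv n ((2 : ℂ)⁻¹ • y),
    ((differentiable_flow n).const_smul (2 : ℂ)).differentiableOn,
    ((differentiable_flowInv n).comp (differentiable_id.const_smul (2 : ℂ)⁻¹)).differentiableOn,
    fun x hx => ?_, fun y hy => ?_, fun x _ => ?_, fun y _ => ?_⟩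
  · rw [mem_ofPred_eq] at hx
    rw [mem_ball_zero_iff, norm_smul, Complex.norm_ofNat]
    linarith
  · rw [mem_ball_zero_iff] at hy
    rw [mem_ofPred_eq, flow_flowInv, norm_smul, norm_inv, Complex.norm_ofNat]
    linarith
  · simp [flowInv_flow]
  · simp [flow_flowInv]

/-! ### Vanishing of the Kobayashi metric -/

/-- The derivatives along the orbit of a point of the basin tend to zero. -/
lemma exists_norm_fderiv_flow_lt {p : EuclideanSpace ℂ (Fin (m + 1))} (hp : green p < 0)
    (ξ : EuclideanSpace ℂ (Fin (m + 1))) :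
    ∃ q < 1 / 2, ∀ ε > 0, ∃ n, ‖flow n p‖ ≤ q ∧ ‖fderiv ℂ (flow n) p ξ‖ < ε := by
  obtain ⟨n, hn⟩ := green_neg_iff.1 hp
  -- The lower bound 1/4 keeps `q` above the truncation level 1/8, as `size_lt_iff` requires.
  obtain ⟨q, hq, hq2⟩ := exists_between (max_lt hn (by norm_num : (1 / 4 : ℝ) < 1 / 2))
  obtain ⟨hq1, hq4⟩ := max_lt_iff.1 hq
  have hline : Continuous fun t : ℂ => p + t • ξ := by fun_prop
  have hnhds : ∀ᶠ t : ℂ in 𝓝 0, ‖flow n (p + t • ξ)‖ < q :=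
    hline.continuousAt.eventually
      ((isOpen_norm_flow_lt n q).mem_nhds (by simpa using hq1))
  obtain ⟨r, hr, hball⟩ := Metric.nhds_basis_closedBall.eventually_iff.1 hnhds
  have hsize : ∀ j, ∀ t ∈ closedBall (0 : ℂ) r, ‖flow (n + j) (p + t • ξ)‖ ≤ (2 * q) ^ 2 ^ j / 2 :=
    fun j t ht => by
      have h1 := (size_lt_iff (by linarith)).2 (hball ht)
      have h2 := size_add_le n j (p + t • ξ)
      have h3 : (2 * size n (p + t • ξ)) ^ 2 ^ j ≤ (2 * q) ^ 2 ^ j := by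
        have := size_pos n (p + t • ξ); gcongr
      have h4 : ‖flow (n + j) (p + t • ξ)‖ ≤ size (n + j) (p + t • ξ) := le_max_left _ _
      linarith
  -- Cauchy's estimate on the disc of radius `r` in the complex line through `p` in direction `ξ`;
  -- `r` does not depend on `j`, while the bound on the orbit is doubly exponentially small.
  have hderiv : ∀ j, ‖fderiv ℂ (flow (n + j)) p ξ‖ ≤ (2 * q) ^ 2 ^ j / 2 / r := fun j => by
    have hd : Differentiable ℂ fun t : ℂ => flow (n + j) (p + t • ξ) :=
      (differentiable_flow _).comp (by fun_prop)
    have hD : HasDerivAt (fun t : ℂ => flow (n + j) (p + t • ξ))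
        (fderiv ℂ (flow (n + j)) p ξ) 0 := by
      have h1 : HasDerivAt (fun t : ℂ => p + t • ξ) ξ 0 := by
        simpa using ((hasDerivAt_id (0 : ℂ)).smul_const ξ).const_add p
      have h2 : HasFDerivAt (flow (n + j)) (fderiv ℂ (flow (n + j)) p) (p + (0 : ℂ) • ξ) := by
        simpa using (differentiable_flow (m := m) (n + j) p).hasFDerivAt
      exact h2.comp_hasDerivAt _ h1
    rw [← hD.deriv]
    exact Complex.norm_deriv_le_of_forall_mem_sphere_norm_le hr hd.diffContOnCl
      fun t ht => hsize j t (sphere_subset_closedBall ht)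
  have hpow : Tendsto (fun j : ℕ => (2 * q) ^ 2 ^ j) atTop (𝓝 0) :=
    (tendsto_pow_atTop_nhds_zero_of_lt_one (by linarith) (by linarith)).comp
      (tendsto_pow_atTop_atTop_of_one_lt (by norm_num : 1 < 2))
  refine ⟨q, hq2, fun ε hε => ?_⟩
  have hlim : Tendsto (fun j : ℕ => (2 * q) ^ 2 ^ j / 2 / r) atTop (𝓝 0) := by
    simpa using (hpow.div_const 2).div_const r
  obtain ⟨j, hj⟩ := (hlim.eventually (gt_mem_nhds hε)).exists
  refine ⟨n + j, ?_, (hderiv j).trans_lt hj⟩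
  have h1 := hsize j 0 (by simp [hr.le])
  have h2 : (2 * q) ^ 2 ^ j ≤ 2 * q :=
    pow_le_of_le_one (by linarith) (by linarith) (by positivity)
  rw [zero_smul, add_zero] at h1
  linarith

/-- For any `α > 0`, choose `n` with the pushed-forward vector `D ξ` shorter than `α * (1 / 2 - q)`.
The affine disc centred at `flow n p` with velocity `α⁻¹ • D ξ` then stays in the ball of radius
1/2, and its pullback by `flowInv n` is an admissible disc with velocity `α⁻¹ • ξ`. -/
lemma kobayashiMetric_green_neg {p : EuclideanSpace ℂ (Fin (m + 1))} (hp : green p < 0)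
    (ξ : EuclideanSpace ℂ (Fin (m + 1))) : kobayashiMetric {x | green x < 0} p ξ = 0 := by
  obtain ⟨q, hq, hn⟩ := exists_norm_fderiv_flow_lt hp ξ
  refine le_antisymm (ENNReal.le_of_forall_pos_le_add fun α hα _ => ?_) zero_le
  have hα' : (0 : ℝ) < α := hα
  obtain ⟨n, hnp, hnξ⟩ := hn (α * (1 / 2 - q)) (mul_pos hα' (by linarith))
  set D := fderiv ℂ (flow n) p with hD
  rw [zero_add, ← ENNReal.ofReal_coe_nnreal]
  have hα0 : ((α : ℝ) : ℂ) ≠ 0 := mod_cast hα'.ne'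
  have hdiff : Differentiable ℂ fun ζ : ℂ => flow n p + ζ • (((α : ℝ) : ℂ)⁻¹ • D ξ) := by fun_prop
  refine iInf₂_le (α : ℝ) ⟨hα', fun ζ => flowInv n (flow n p + ζ • (((α : ℝ) : ℂ)⁻¹ • D ξ)),
    ((differentiable_flowInv n).comp hdiff).differentiableOn, fun ζ hζ => ?_, ?_, ?_⟩
  · refine green_neg_iff.2 ⟨n, ?_⟩
    rw [mem_ball_zero_iff] at hζ
    have h1 : ‖((α : ℝ) : ℂ)⁻¹ • D ξ‖ < 1 / 2 - q := by
      rw [norm_smul, norm_inv, Complex.norm_real, Real.norm_of_nonneg hα'.le,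
        inv_mul_lt_iff₀ hα']
      exact hnξ
    have h2 : ‖ζ • (((α : ℝ) : ℂ)⁻¹ • D ξ)‖ ≤ ‖((α : ℝ) : ℂ)⁻¹ • D ξ‖ := by
      rw [norm_smul]; exact mul_le_of_le_one_left (norm_nonneg _) hζ.le
    rw [flow_flowInv]
    linarith [norm_add_le (flow n p) (ζ • (((α : ℝ) : ℂ)⁻¹ • D ξ))]
  · simp [flowInv_flow]
  · have h1 : HasDerivAt (fun ζ : ℂ => flow n p + ζ • (((α : ℝ) : ℂ)⁻¹ • D ξ))
        (((α : ℝ) : ℂ)⁻¹ • D ξ) 0 := by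
      simpa using ((hasDerivAt_id (0 : ℂ)).smul_const (((α : ℝ) : ℂ)⁻¹ • D ξ)).const_add (flow n p)
    have h2 : HasFDerivAt (flowInv n) (fderiv ℂ (flowInv n) (flow n p)) (flow n p) :=
      (differentiable_flowInv (m := m) n _).hasFDerivAt
    have h3 : HasFDerivAt (flow n) D p := (differentiable_flow (m := m) n p).hasFDerivAt
    have h4 : (fderiv ℂ (flowInv n) (flow n p)).comp D = ContinuousLinearMap.id ℂ _ := by
      refine (h2.comp p h3).unique ?_
      have : flowInv n ∘ flow n = (id : EuclideanSpace ℂ (Fin (m + 1)) → _) :=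
        funext (flowInv_flow n)
      rw [this]
      exact hasFDerivAt_id p
    have h5 : HasDerivAt (fun ζ : ℂ => flowInv n (flow n p + ζ • (((α : ℝ) : ℂ)⁻¹ • D ξ)))
        (fderiv ℂ (flowInv n) (flow n p) (((α : ℝ) : ℂ)⁻¹ • D ξ)) 0 :=
      HasFDerivAt.comp_hasDerivAt (0 : ℂ) (by simpa using h2) h1
    rw [h5.deriv, map_smul, smul_inv_smul₀ hα0]
    exact DFunLike.congr_fun h4 ξ

/-! ### Non-constancy of the Green type function -/

open scoped ComplexOrder in
/-- Orbits of points with nonnegative real coordinates decrease at most quadratically. -/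
lemma pow_le_size {b : ℝ} (hb : 0 ≤ b) (i : Fin m) (n : ℕ) :
    b ^ 2 ^ n ≤ size n (EuclideanSpace.single i.castSucc (b : ℂ)) := by
  -- Nonnegative real coordinates allow no cancellation: coordinate `i.castSucc` is at least squared
  -- at each step, and the added linear term is nonnegative.
  have h : (∀ j, 0 ≤ flow n (EuclideanSpace.single i.castSucc (b : ℂ)) j) ∧
      ((b ^ 2 ^ n : ℝ) : ℂ) ≤ flow n (EuclideanSpace.single i.castSucc (b : ℂ)) i.castSucc := by
    induction n with
    | zero =>
      refine ⟨fun j => ?_, by simp [flow]⟩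
      by_cases hj : j = i.castSucc
      · simp [flow, hj, hb]
      · simp [flow, hj]
    | succ n ih =>
      obtain ⟨h1, h2⟩ := ih
      have hp : (0 : ℂ) ≤ param n := mod_cast (param_pos n).le
      refine ⟨fun j => ?_, ?_⟩
      · induction j using Fin.lastCases with
        | last => rw [flow, squareShift_last]; exact mul_nonneg hp (h1 _)
        | cast j =>
          rw [flow, squareShift_castSucc]
          exact add_nonneg (pow_nonneg (h1 _) _) (mul_nonneg hp (h1 _))
      · rw [flow, squareShift_castSucc, pow_succ, pow_mul, Complex.ofReal_pow]
        exact le_add_of_le_of_nonneg (pow_le_pow_left₀ (mod_cast by positivity) h2 2)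
          (mul_nonneg hp (h1 _))
  have h1 := (Complex.le_def.1 h.2).1
  rw [Complex.ofReal_re] at h1
  exact h1.trans ((Complex.re_le_norm _).trans ((PiLp.norm_apply_le _ _).trans (le_max_left _ _)))

/-- At the origin, `potential 0` already equals `log (2 * (1 / 8)) = log (1 / 4)`. At the point 1/3
on a non-last axis, which lies in the ball of radius 1/2, `green` is at least `log (1 / 3)`. -/
lemma exists_green_ne (i : Fin m) : ∃ z : EuclideanSpace ℂ (Fin (m + 1)), green z < 0 ∧
    ∃ w : EuclideanSpace ℂ (Fin (m + 1)), green w < 0 ∧ green z ≠ green w := by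
  have h0 : green (0 : EuclideanSpace ℂ (Fin (m + 1))) ≤ Real.log (1 / 4) := by
    refine (ciInf_le (bddBelow_potential _) 0).trans (le_of_eq ?_)
    norm_num [potential, size, flow, param]
  have h1 : Real.log (1 / 3) ≤ green (EuclideanSpace.single i.castSucc ((1 / 3 : ℝ) : ℂ)) :=
    le_ciInf fun n => log_le_potential (by norm_num) (pow_le_size (by norm_num) i n)
  have h2 : Real.log (1 / 4) < Real.log (1 / 3) := Real.log_lt_log (by norm_num) (by norm_num)
  refine ⟨0, h0.trans_lt (Real.log_neg (by norm_num) (by norm_num)), _,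
    green_neg_iff.2 ⟨0, ?_⟩, (h0.trans_lt (h2.trans_le h1)).ne⟩
  rw [flow, PiLp.norm_single, Complex.norm_real]
  norm_num

/-- The basin of the sequence of automorphisms is a Short `ℂ^(m+1)`. -/
lemma isShort_green_neg (i : Fin m) :
    IsShort {x : EuclideanSpace ℂ (Fin (m + 1)) | green x < 0} where
  isOpen := by
    rw [setOf_green_neg_eq_iUnion]
    exact isOpen_iUnion fun n => isOpen_norm_flow_lt n _
  isConnected := isConnected_green_neg
  exhaustion := ⟨fun n => {x | ‖flow n x‖ < 1 / 2}, fun n => isOpen_norm_flow_lt n _,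
    fun _ _ => norm_flow_succ_lt, biholomorphic_norm_flow_lt, setOf_green_neg_eq_iUnion⟩
  kobayashi_eq_zero := fun _ hp ξ => kobayashiMetric_green_neg hp ξ
  sublevel := ⟨green, plurisubharmonicOn_green,
    ⟨Real.log (1 / 8), fun z => le_ciInf fun n => log_one_eighth_le_potential n z⟩, rfl, exists_green_ne i⟩

/-! ### Position of the basin and its affine copies -/

/-- The basin lies in a conical neighbourhood of the last coordinate axis. -/
lemma norm_apply_lt_of_green_neg {x : EuclideanSpace ℂ (Fin (m + 1))} (hx : green x < 0)
    {j : Fin (m + 1)} (hj : j ≠ Fin.last m) : ‖x j‖ < max 2 ‖x (Fin.last m)‖ := by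
  by_contra! hcon
  obtain ⟨i, rfl⟩ := Fin.exists_castSucc_eq.2 hj
  obtain ⟨n, hn⟩ := green_neg_iff.1 hx
  -- The escape condition is forward invariant and keeps some coordinate of norm at least 2, so the
  -- orbit never enters the ball of radius 1/2.
  have hesc : ∀ n, ∃ i : Fin m, 2 ≤ ‖flow n x i.castSucc‖ ∧
      ‖flow n x (Fin.last m)‖ ≤ ‖flow n x i.castSucc‖ := fun n => by
    induction n with
    | zero => exact ⟨i, max_le_iff.1 hcon⟩
    | succ n ih => exact exists_dominating_squareShift (norm_param_le_one n) ih
  obtain ⟨i, hi, -⟩ := hesc n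
  have := PiLp.norm_apply_le (flow n x) i.castSucc
  linarith

/-- Affine images of Short `ℂ^k`'s are Short `ℂ^k`'s. -/
lemma IsShort.preimage_affine {k : ℕ} {Ω : Set (EuclideanSpace ℂ (Fin k))} (hΩ : IsShort Ω)
    (L : EuclideanSpace ℂ (Fin k) ≃L[ℂ] EuclideanSpace ℂ (Fin k))
    (v : EuclideanSpace ℂ (Fin k)) : IsShort {x | L (x - v) ∈ Ω} := by
  have hT : Differentiable ℂ fun x => L (x - v) := by fun_prop
  have hS : Differentiable ℂ fun y => L.symm y + v := by fun_prop
  have hTS : ∀ y, L (L.symm y + v - v) = y := fun y => by simp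
  have hST : ∀ x, L.symm (L (x - v)) + v = x := fun x => by simp
  have himage : ∀ U : Set (EuclideanSpace ℂ (Fin k)),
      {x | L (x - v) ∈ U} = (fun y => L.symm y + v) '' U := fun U => by
    ext x
    exact ⟨fun h => ⟨_, h, hST x⟩, by rintro ⟨y, hy, rfl⟩; simpa using hy⟩
  refine ⟨hΩ.isOpen.preimage hT.continuous, ?_, ?_, fun p hp ξ => ?_, ?_⟩
  · rw [himage]
    exact hΩ.isConnected.image _ hS.continuous.continuousOn
  · obtain ⟨U, hUo, hUm, hUb, rfl⟩ := hΩ.exhaustion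
    refine ⟨fun j => {x | L (x - v) ∈ U j}, fun j => (hUo j).preimage hT.continuous,
      fun j x hx => hUm j hx, fun j => ?_, by ext x; simp⟩
    obtain ⟨f, g, hf, hg, hfm, hgm, hgf, hfg⟩ := hUb j
    refine ⟨fun x => f (L (x - v)), fun y => L.symm (g y) + v,
      hf.comp hT.differentiableOn fun x hx => hx, hS.comp_differentiableOn hg,
      fun x hx => hfm hx, fun y hy => ?_, fun x hx => ?_, fun y hy => ?_⟩
    · simpa using hgm hy
    · simp only [hgf hx, hST]
    · simp only [hTS, hfg hy]
  · rw [← nonpos_iff_eq_zero, ← hΩ.kobayashi_eq_zero _ hp (L ξ)]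
    refine le_iInf₂ fun α ⟨hα, f, hf, hfm, hf0, hfξ⟩ => iInf₂_le α ⟨hα, fun ζ => L.symm (f ζ) + v,
      hS.comp_differentiableOn hf, fun ζ hζ => by simpa using hfm hζ, by simp [hf0], ?_⟩
    have hd : HasDerivAt f (deriv f 0) 0 :=
      (hf.differentiableAt (ball_mem_nhds 0 one_pos)).hasDerivAt
    have hd' : HasDerivAt (fun ζ => L.symm (f ζ) + v) (L.symm (deriv f 0)) 0 :=
      (L.symm.toContinuousLinearMap.hasFDerivAt.comp_hasDerivAt 0 hd).add_const v
    rw [hd'.deriv, ← map_smul, hfξ, L.symm_apply_apply]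
  · obtain ⟨φ, hφ, ⟨c, hc⟩, rfl, z, hz, w, hw, hzw⟩ := hΩ.sublevel
    exact ⟨fun x => φ (L (x - v)), hφ.comp_affine L.toContinuousLinearMap v, ⟨c, fun x => hc _⟩,
      rfl, L.symm z + v, by simpa using hz, L.symm w + v, by simpa using hw, by simpa using hzw⟩

end ShortCk

/-! ### Pairwise disjoint copies -/

theorem theorem1p3 (k : ℕ) (hk : 3 ≤ k) :
    ∃ Ω : Fin (k - 1) → Set (EuclideanSpace ℂ (Fin k)),
      (∀ i, ShortCk.IsShort (Ω i)) ∧ ∀ i j, i ≠ j → Ω i ∩ Ω j = ∅ := by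
  obtain ⟨m, rfl⟩ : ∃ m, k = m + 1 := ⟨k - 1, by omega⟩
  change ∃ Ω : Fin m → Set (EuclideanSpace ℂ (Fin (m + 1))), _
  -- The `i`-th copy is turned so that axis `i.castSucc` plays the role of the last axis. The shifts
  -- `v i` run along the actual last axis, so they do not affect the coordinates `l.castSucc`.
  let L : Fin m → EuclideanSpace ℂ (Fin (m + 1)) ≃L[ℂ] EuclideanSpace ℂ (Fin (m + 1)) := fun i =>
    (LinearIsometryEquiv.piLpCongrLeft 2 ℂ ℂ
      (Equiv.swap (Fin.last m) i.castSucc)).toContinuousLinearEquiv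
  let v : Fin m → EuclideanSpace ℂ (Fin (m + 1)) := fun i =>
    EuclideanSpace.single (Fin.last m) (4 * (i : ℕ) : ℂ)
  have hcone : ∀ i x, L i (x - v i) ∈ {x | ShortCk.green x < 0} → ∀ j ≠ i.castSucc,
      ‖(x - v i) j‖ < max 2 ‖x i.castSucc‖ := fun i x hx j hj => by
    have hne : Equiv.swap (Fin.last m) i.castSucc j ≠ Fin.last m := fun h =>
      hj (by rw [← Equiv.swap_apply_self (Fin.last m) i.castSucc j, h, Equiv.swap_apply_left])
    have hL : ∀ l, L i (x - v i) l = (x - v i) (Equiv.swap (Fin.last m) i.castSucc l) :=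
      fun l => rfl
    have h := ShortCk.norm_apply_lt_of_green_neg hx hne
    rw [hL, hL, Equiv.swap_apply_self, Equiv.swap_apply_left] at h
    have hv : (x - v i) i.castSucc = x i.castSucc := by simp [v, Fin.castSucc_ne_last]
    rwa [hv] at h
  refine ⟨fun i => {x | L i (x - v i) ∈ {x | ShortCk.green x < 0}},
    fun i => (ShortCk.isShort_green_neg i).preimage_affine (L i) (v i), fun i j hij => ?_⟩
  rw [Set.eq_empty_iff_forall_notMem]
  rintro x ⟨hi, hj⟩
  have hcij : i.castSucc ≠ j.castSucc := fun h => hij (Fin.castSucc_injective m h)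
  have hv : ∀ i l : Fin m, (x - v i) l.castSucc = x l.castSucc := fun i l => by
    simp [v, Fin.castSucc_ne_last]
  have h1 := hcone i x hi j.castSucc hcij.symm
  have h2 := hcone j x hj i.castSucc hcij
  have h3 := hcone i x hi (Fin.last m) (Fin.castSucc_ne_last i).symm
  have h4 := hcone j x hj (Fin.last m) (Fin.castSucc_ne_last j).symm
  rw [hv] at h1 h2
  -- If `‖x i.castSucc‖ ≥ 2`, the two cone conditions would make each of the two axis coordinates
  -- strictly larger than the other.
  have hxi : ‖x i.castSucc‖ < 2 := by
    by_contra! hcon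
    rcases lt_max_iff.1 h2 with h | h
    · linarith
    · rw [max_eq_right hcon] at h1; linarith
  have hxj : ‖x j.castSucc‖ < 2 := h1.trans_le (max_le le_rfl hxi.le)
  rw [max_eq_left hxi.le] at h3
  rw [max_eq_left hxj.le] at h4
  -- The last coordinate is within 2 of both `4 * i` and `4 * j`, which are at least 4 apart.
  have hdist : ‖(4 * (i : ℕ) : ℂ) - 4 * (j : ℕ)‖ < 4 := by
    have h := norm_sub_le ((x - v j) (Fin.last m)) ((x - v i) (Fin.last m))
    have he : (x - v j) (Fin.last m) - (x - v i) (Fin.last m) =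
        (4 * (i : ℕ) : ℂ) - 4 * (j : ℕ) := by simp [v]
    rw [he] at h
    linarith
  rw [← mul_sub, norm_mul, Complex.norm_ofNat] at hdist
  have hint : (1 : ℝ) ≤ ‖((i : ℕ) : ℂ) - ((j : ℕ) : ℂ)‖ := by
    have hne : ((i : ℕ) : ℤ) - ((j : ℕ) : ℤ) ≠ 0 := fun h => hij (Fin.ext (by omega))
    have h : (1 : ℝ) ≤ |((((i : ℕ) : ℤ) - ((j : ℕ) : ℤ) : ℤ) : ℝ)| := by
      rw [← Int.cast_abs, ← Int.cast_one, Int.cast_le]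
      exact Int.one_le_abs hne
    rw [← Complex.norm_intCast] at h
    simpa using h
  linarith
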